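/- Let $(W,S)$ be a Coxeter system ($S$ and $W$ may be infinite), with length function $\ell$, and let $\bar S$ be the set of classes of elements of $S$ under conjugacy in $W$; write $\bar s$ for the class of $s\in S$. Let $\Gamma$ be a totally ordered abelian group (the order being compatible with the group law) and let $\varphi:\bar S\to\Gamma$ be any map; put $\varphi(s)=\varphi(\bar s)$. Let $\mathbb Z[\Gamma]=\bigoplus_{\gamma\in\Gamma}\mathbb Z e^{\gamma}$ be the group ring and let $\mathcal H(W,S,\varphi)$ be the Hecke algebra: the free $\mathbb Z[\Gamma]$-module with basis $(T_w^\varphi)_{w\in W}$ and with the $\mathbb Z[\Gamma]$-bilinear associative multiplication such that $T_wT_{w'}=T_{ww'}$ if $\ell(ww')=\ell(w)+\ell(w')$ and $(T_s-e^{\varphi(s)})(T_s+e^{-\varphi(s)})=0$ for $s\in S$. Let $h\mapsto\overline h$ be the antilinear involution of $\mathcal H(W,S,\varphi)$ with $\overline{e^\gamma}=e^{-\gamma}$ and $\overline{T_w}=T_{w^{-1}}^{-1}$. For $w\in W$, let $C_w^\varphi$ be the unique element of $\mathcal H(W,S,\varphi)$ such that $\overline{C_w^\varphi}=C_w^\varphi$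 and $C_w^\varphi-T_w^\varphi\in\bigoplus_{v\in W}\mathbb Z[\Gamma_{<0}]\,T_v^\varphi$, where $\mathbb Z[\Gamma_{<0}]=\bigoplus_{\gamma<0}\mathbb Z e^\gamma$; the family $(C_w^\varphi)_{w\in W}$ is a $\mathbb Z[\Gamma]$-basis of $\mathcal H(W,S,\varphi)$. For $x,y\in W$ write $x\leftarrow_L^\varphi y$ (respectively $x\leftarrow_R^\varphi y$, respectively $x\leftarrow_{LR}^\varphi y$) if there is $h\in\mathcal H(W,S,\varphi)$ such that the coefficient of $C_x^\varphi$ in $hC_y^\varphi$ (respectively in $C_y^\varphi h$, respectively in $hC_y^\varphi$ or in $C_y^\varphi h$), written in the basis $(C_w^\varphi)_{w\in W}$, is non-zero. For $?\in\{L,R,LR\}$, let $\leqslant_?^\varphi$ be the transitive closure of $\leftarrow_?^\varphi$ (a preorder), let $\sim_?^\varphi$ be the associated equivalence relation ($x\sim_?^\varphi y$ if and only if $x\leqslant_?^\varphi y$ and $y\leqslant_?^\varphi x$), and let $\mathrm{Cell}_?^\varphi(w)=\{x\in W : x\sim_?^\varphi w\}$. Proposition. Let $\Gamma'$ be a totally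 ordered abelian group, let $\rho:\Gamma\to\Gamma'$ be a strictly increasing morphism of groups and let $?\in\{L,R,LR\}$. Let $\rho_*:\mathcal H(W,S,\varphi)\to\mathcal H(W,S,\rho\circ\varphi)$ be the map, semilinear with respect to the ring morphism $\mathbb Z[\Gamma]\to\mathbb Z[\Gamma']$, $e^\gamma\mapsto e^{\rho(\gamma)}$, that sends $T_w^\varphi$ to $T_w^{\rho\circ\varphi}$ for all $w\in W$. Then: (a) $\rho_*$ is injective. (b) For all $w\in W$, $\rho_*(C_w^\varphi)=C_w^{\rho\circ\varphi}$. (c) The relations $\leqslant_?^\varphi$ and $\leqslant_?^{\rho\circ\varphi}$ coincide, and the relations $\sim_?^\varphi$ and $\sim_?^{\rho\circ\varphi}$ coincide. (d) For all $w\in W$, $\mathrm{Cell}_?^\varphi(w)=\mathrm{Cell}_?^{\rho\circ\varphi}(w)$. -/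

import Mathlib

noncomputable section

namespace HeckeKL

section Combinatorics

theorem endMul_apply {X : Type*} (f g : Function.End X) (x : X) : (f * g) x = f (g x) := rfl

theorem endOne_apply {X : Type*} (x : X) : (1 : Function.End X) x = x := rfl

variable {B W : Type*} [Group W] {M : CoxeterMatrix B} (cs : CoxeterSystem M W)

open Classical in
/-- The action of a simple reflection on `W × ℤ/2ℤ`, used only to prove `length_exchange`. -/
def twist (i : B) : Function.End (W × ZMod 2) := fun p =>
  (cs.simple i * p.1 * cs.simple i, p.2 + if p.1 = cs.simple i then 1 else 0)

open Classical in
theorem twist_pow (i j : B) (m : ℕ) (r : W) (ε : ZMod 2) :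
    ((twist cs i * twist cs j) ^ m) (r, ε) =
      ((cs.simple i * cs.simple j) ^ m * r * ((cs.simple i * cs.simple j) ^ m)⁻¹,
        ε + ∑ k ∈ Finset.range (2 * m),
          if r = ((cs.simple i * cs.simple j) ^ k)⁻¹ * cs.simple j then 1 else 0) := by
  induction m with
  | zero => simp [endOne_apply]
  | succ m ih =>
    rw [pow_succ', endMul_apply, ih]
    set c := cs.simple i * cs.simple j with hc
    have hcinv : c⁻¹ = cs.simple j * cs.simple i := by simp [hc]
    have hji : cs.simple j * c ^ m = (c ^ m)⁻¹ * cs.simple j := by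
      have h1 : cs.simple j * c * (cs.simple j)⁻¹ = c⁻¹ := by
        rw [hcinv, hc]; simp [mul_assoc]
      have h2 : cs.simple j * c ^ m * (cs.simple j)⁻¹ = (c ^ m)⁻¹ := by
        rw [← conj_pow, h1, inv_pow]
      rw [← h2]; simp
    have h2m : c ^ (2 * m) = c ^ m * c ^ m := by rw [two_mul, pow_add]
    simp only [endMul_apply, twist]
    rw [show 2 * (m + 1) = 2 * m + 1 + 1 by ring, Finset.sum_range_succ, Finset.sum_range_succ]
    have e1 : (c ^ m * r * (c ^ m)⁻¹ = cs.simple j) ↔ r = (c ^ (2 * m))⁻¹ * cs.simple j := by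
      have h3 : (c ^ (2 * m))⁻¹ * cs.simple j = (c ^ m)⁻¹ * cs.simple j * c ^ m := by
        rw [h2m, mul_inv_rev]
        simp only [mul_assoc]
        rw [hji]
      rw [h3]
      constructor
      · intro h; rw [← h]; group
      · rintro rfl; group
    have e2 : (cs.simple j * (c ^ m * r * (c ^ m)⁻¹) * cs.simple j = cs.simple i) ↔
        r = (c ^ (2 * m + 1))⁻¹ * cs.simple j := by
      have h4 : c ^ (2 * m + 1) = c ^ m * c * c ^ m := by
        rw [← pow_succ, ← pow_add]; congr 1; ring
      have h3 : (c ^ (2 * m + 1))⁻¹ * cs.simple j =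
          (c ^ m)⁻¹ * (cs.simple j * cs.simple i * cs.simple j) * c ^ m := by
        rw [h4, mul_inv_rev, mul_inv_rev, hcinv]
        simp only [mul_assoc]
        rw [hji]
      rw [h3]
      constructor
      · intro h
        rw [← h]
        simp [mul_assoc]
      · rintro rfl
        simp [mul_assoc]
    simp only [e1, e2, Prod.mk.injEq]
    constructor
    · rw [pow_succ', mul_inv_rev, hcinv, hc]
      simp only [mul_assoc]
    · ring

theorem twist_liftable : M.IsLiftable (twist cs) := by
  classical
  intro i j
  funext p
  obtain ⟨r, ε⟩ := p
  rw [twist_pow, two_mul, Finset.sum_range_add]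
  have hp : (cs.simple i * cs.simple j) ^ M i j = 1 := cs.simple_mul_simple_pow i j
  simp only [pow_add, hp, one_mul, inv_one, mul_one]
  rw [CharTwo.add_self_eq_zero]
  simp [endOne_apply]

/-- The extension of `twist` to `W`. -/
def twistHom : W →* Function.End (W × ZMod 2) := cs.lift ⟨twist cs, twist_liftable cs⟩

theorem twistHom_simple (i : B) : twistHom cs (cs.simple i) = twist cs i :=
  cs.lift_apply_simple (twist_liftable cs) i

open Classical in
theorem twistHom_wordProd (ω : List B) (r : W) (ε : ZMod 2) :
    twistHom cs (cs.wordProd ω) (r, ε) =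
      (cs.wordProd ω * r * (cs.wordProd ω)⁻¹, ε + ((cs.rightInvSeq ω).count r : ZMod 2)) := by
  induction ω with
  | nil => simp [endOne_apply]
  | cons i ω ih =>
    rw [cs.wordProd_cons, map_mul, endMul_apply, ih, twistHom_simple]
    have e : (cs.wordProd ω * r * (cs.wordProd ω)⁻¹ = cs.simple i) ↔
        (cs.wordProd ω)⁻¹ * cs.simple i * cs.wordProd ω = r := by
      constructor
      · intro h; rw [← h]; group
      · rintro rfl; group
    simp only [twist, CoxeterSystem.rightInvSeq, List.count_cons, e, beq_iff_eq, Prod.mk.injEq]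
    constructor
    · simp [mul_assoc]
    · push_cast
      ring

/-- The parity of the number of occurrences of `r` in the inversion sequence of a word for `w`. -/
def invParity (w r : W) : ZMod 2 := (twistHom cs w (r, 0)).2

theorem twistHom_apply (w r : W) (ε : ZMod 2) :
    twistHom cs w (r, ε) = (w * r * w⁻¹, ε + invParity cs w r) := by
  obtain ⟨ω, rfl⟩ := cs.wordProd_surjective w
  simp [invParity, twistHom_wordProd]

theorem invParity_mul (w v r : W) :
    invParity cs (w * v) r = invParity cs v r + invParity cs w (v * r * v⁻¹) := by
  have := twistHom_apply cs (w * v) r 0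
  rw [map_mul, endMul_apply, twistHom_apply, twistHom_apply] at this
  simpa using (congrArg Prod.snd this).symm

open Classical in
theorem invParity_simple (i : B) (r : W) :
    invParity cs (cs.simple i) r = if r = cs.simple i then 1 else 0 := by
  simp [invParity, twistHom_simple, twist]

theorem isRightInversion_of_invParity {w r : W} (h : invParity cs w r ≠ 0) :
    cs.IsRightInversion w r := by
  classical
  obtain ⟨ω, hω, rfl⟩ := cs.exists_isReduced w
  apply cs.isRightInversion_of_mem_rightInvSeq hω
  by_contra hr
  apply h
  simp [invParity, twistHom_wordProd, List.count_eq_zero_of_not_mem hr]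

theorem isRightDescent_iff_invParity (w : W) (i : B) :
    cs.length (w * cs.simple i) < cs.length w ↔ invParity cs w (cs.simple i) ≠ 0 := by
  constructor
  · intro h h0
    have h1 : invParity cs (w * cs.simple i) (cs.simple i) ≠ 0 := by
      rw [invParity_mul, invParity_simple]
      simp [h0]
    have h2 := (isRightInversion_of_invParity cs h1).2
    rw [mul_assoc, cs.simple_mul_simple_self, mul_one] at h2
    omega
  · intro h
    exact (isRightInversion_of_invParity cs h).2

/-- If `s w ≠ w t`, then `t` is a right descent of `s w` if and only if it is one of `w`. -/
theorem length_exchange (w : W) (i j : B) (h : cs.simple i * w ≠ w * cs.simple j) :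
    cs.length (cs.simple i * w * cs.simple j) < cs.length (cs.simple i * w) ↔
      cs.length (w * cs.simple j) < cs.length w := by
  rw [isRightDescent_iff_invParity, isRightDescent_iff_invParity, invParity_mul, invParity_simple,
    if_neg, add_zero]
  intro h'
  apply h
  rw [← h']
  group

/-- If `s w ≠ w t`, then `s` is a left descent of `w t` if and only if it is one of `w`. -/
theorem length_exchange' (w : W) (i j : B) (h : cs.simple i * w ≠ w * cs.simple j) :
    cs.length (cs.simple i * w * cs.simple j) < cs.length (w * cs.simple j) ↔
      cs.length (cs.simple i * w) < cs.length w := by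
  have h' : cs.simple j * w⁻¹ ≠ w⁻¹ * cs.simple i := by
    intro e
    apply h
    have := congrArg (fun x => x⁻¹) e
    simpa using this.symm
  have := length_exchange cs w⁻¹ j i h'
  rw [← cs.length_inv (cs.simple j * w⁻¹ * cs.simple i), ← cs.length_inv (cs.simple j * w⁻¹),
    ← cs.length_inv (w⁻¹ * cs.simple i), cs.length_inv w] at this
  simpa [mul_assoc] using this

end Combinatorics

section Algebra

variable {B W : Type*} [Group W] {M : CoxeterMatrix B}

/-- Simple reflections are identified when they are conjugate in `W`. -/
def conjSetoid (cs : CoxeterSystem M W) : Setoid B where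
  r i j := IsConj (cs.simple i) (cs.simple j)
  iseqv := ⟨fun _ => IsConj.refl _, fun h => h.symm, fun h h' => h.trans h'⟩

/-- The set of classes of simple reflections under conjugacy in `W`. -/
abbrev SimpleClass (cs : CoxeterSystem M W) : Type _ := Quotient (conjSetoid cs)

/-- The conjugacy class of the simple reflection of index `i`. -/
def simpleClass (cs : CoxeterSystem M W) (i : B) : SimpleClass cs :=
  Quotient.mk (conjSetoid cs) i

/-- The group ring `ℤ[Γ]`. -/
abbrev GroupRing (Γ : Type*) [AddCommGroup Γ] : Type _ := AddMonoidAlgebra ℤ Γ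

/-- The element `e ^ γ` of the group ring `ℤ[Γ]`. -/
def expo {Γ : Type*} [AddCommGroup Γ] (γ : Γ) : GroupRing Γ := AddMonoidAlgebra.single γ 1

theorem expo_mul_expo {Γ : Type*} [AddCommGroup Γ] (γ δ : Γ) :
    expo γ * expo δ = expo (γ + δ) := by
  simp [expo, AddMonoidAlgebra.single_mul_single]

theorem expo_zero {Γ : Type*} [AddCommGroup Γ] : expo (0 : Γ) = 1 := rfl

/-- The ring morphism `ℤ[Γ] → ℤ[Γ']` induced by a morphism of groups: `e ^ γ ↦ e ^ (ρ γ)`. -/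
abbrev groupRingMap {Γ Γ' : Type*} [AddCommGroup Γ] [AddCommGroup Γ'] (ρ : Γ →+ Γ') :
    GroupRing Γ →+* GroupRing Γ' := AddMonoidAlgebra.mapDomainRingHom ℤ ρ

theorem groupRingMap_expo {Γ Γ' : Type*} [AddCommGroup Γ] [AddCommGroup Γ'] (ρ : Γ →+ Γ') (γ : Γ) :
    groupRingMap ρ (expo γ) = expo (ρ γ) := AddMonoidAlgebra.mapDomain_single

/-- The involution `e ^ γ ↦ e ^ (-γ)` of the group ring `ℤ[Γ]`. -/
abbrev barCoeff (Γ : Type*) [AddCommGroup Γ] : GroupRing Γ →+* GroupRing Γ :=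
  groupRingMap (negAddMonoidHom : Γ →+ Γ)

/-- The underlying free `ℤ[Γ]`-module of the Hecke algebra with parameter `φ`. -/
def Hecke (cs : CoxeterSystem M W) {Γ : Type*} [AddCommGroup Γ] (_φ : SimpleClass cs → Γ) :
    Type _ := W →₀ GroupRing Γ

variable {cs : CoxeterSystem M W} {Γ : Type*} [AddCommGroup Γ] {φ : SimpleClass cs → Γ}

instance : AddCommGroup (Hecke cs φ) := inferInstanceAs (AddCommGroup (W →₀ GroupRing Γ))

instance : Module (GroupRing Γ) (Hecke cs φ) :=
  inferInstanceAs (Module (GroupRing Γ) (W →₀ GroupRing Γ))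

variable (φ) in
/-- The standard basis `(T_w)` of the Hecke algebra. -/
def T : Module.Basis W (GroupRing Γ) (Hecke cs φ) :=
  Module.Basis.ofRepr (LinearEquiv.refl (GroupRing Γ) (W →₀ GroupRing Γ))

theorem hecke_induction {p : Hecke cs φ → Prop} (h : Hecke cs φ) (zero : p 0)
    (add : ∀ x y, p x → p y → p (x + y)) (smul : ∀ (a : GroupRing Γ) (w : W), p (a • T φ w)) : p h := by
  rw [← (T φ).linearCombination_repr h, Finsupp.linearCombination_apply, Finsupp.sum]
  exact Finset.sum_induction _ p add zero fun w _ => smul _ _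

variable (φ) in
/-- The difference `e ^ φ(s) - e ^ (-φ(s))`. -/
def xi (i : B) : GroupRing Γ := expo (φ (simpleClass cs i)) - expo (-φ (simpleClass cs i))

open Classical in
variable (φ) in
/-- Left multiplication by `T_s`. -/
def leftOp (i : B) : Module.End (GroupRing Γ) (Hecke cs φ) :=
  (T φ).constr (GroupRing Γ) fun w =>
    if cs.length w < cs.length (cs.simple i * w) then T φ (cs.simple i * w)
    else T φ (cs.simple i * w) + xi φ i • T φ w

open Classical in
variable (φ) in
/-- Right multiplication by `T_s`. -/
def rightOp (i : B) : Module.End (GroupRing Γ) (Hecke cs φ) :=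
  (T φ).constr (GroupRing Γ) fun w =>
    if cs.length w < cs.length (w * cs.simple i) then T φ (w * cs.simple i)
    else T φ (w * cs.simple i) + xi φ i • T φ w

open Classical in
theorem leftOp_T (i : B) (w : W) : leftOp φ i (T φ w) = T φ (cs.simple i * w) +
    (if cs.length (cs.simple i * w) < cs.length w then xi φ i else 0) • T φ w := by
  rw [leftOp, Module.Basis.constr_basis]
  have := cs.length_simple_mul_ne w i
  split_ifs <;> first | omega | simp

open Classical in
theorem rightOp_T (i : B) (w : W) : rightOp φ i (T φ w) = T φ (w * cs.simple i) +
    (if cs.length (w * cs.simple i) < cs.length w then xi φ i else 0) • T φ w := by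
  rw [rightOp, Module.Basis.constr_basis]
  have := cs.length_mul_simple_ne w i
  split_ifs <;> first | omega | simp

theorem leftOp_rightOp (i j : B) (h : Hecke cs φ) :
    leftOp φ i (rightOp φ j h) = rightOp φ j (leftOp φ i h) := by
  classical
  suffices leftOp φ i ∘ₗ rightOp φ j = rightOp φ j ∘ₗ leftOp φ i from LinearMap.congr_fun this h
  refine (T φ).ext fun w => ?_
  simp only [LinearMap.comp_apply, leftOp_T, rightOp_T, map_add, map_smul, smul_add, ← mul_assoc]
  by_cases hw : cs.simple i * w = w * cs.simple j
  · have hxi : xi φ i = xi φ j := by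
      have : simpleClass cs i = simpleClass cs j := by
        refine Quotient.sound (s := conjSetoid cs) ?_
        refine (isConj_iff.2 ⟨w⁻¹, ?_⟩ : IsConj (cs.simple i) (cs.simple j))
        rw [mul_assoc, inv_inv, hw]
        simp
      rw [xi, xi, this]
    have e1 : w * cs.simple j * cs.simple j = w := by simp
    rw [hw, e1, hxi]
  · have h1 := length_exchange cs w i j hw
    have h2 := length_exchange' cs w i j hw
    simp only [h1, h2, smul_smul]
    split_ifs <;> simp only [zero_smul, mul_comm (xi φ i), zero_mul, mul_zero] <;> abel

theorem hecke_ext {f g : Module.End (GroupRing Γ) (Hecke cs φ)}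
    (hf : ∀ i h, f (rightOp φ i h) = rightOp φ i (f h))
    (hg : ∀ i h, g (rightOp φ i h) = rightOp φ i (g h))
    (h1 : f (T φ 1) = g (T φ 1)) : f = g := by
  refine (T φ).ext fun w => ?_
  induction hn : cs.length w generalizing w with
  | zero => rw [cs.length_eq_zero_iff.1 hn, h1]
  | succ n ih =>
    obtain ⟨i, hi⟩ := cs.exists_rightDescent_of_ne_one (w := w) (by
      rintro rfl
      simp at hn)
    have hlen := cs.isRightDescent_iff.1 hi
    have hT : T φ w = rightOp φ i (T φ (w * cs.simple i)) := by
      rw [rightOp_T, if_neg]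
      · simp
      · simp only [cs.simple_mul_simple_cancel_right]
        omega
    rw [hT, hf, hg, ih _ (by omega)]

variable (cs) in
/-- A chosen reduced word of `w`. -/
def redWord (w : W) : List B := (cs.exists_isReduced w).choose

theorem redWord_isReduced (w : W) : cs.IsReduced (redWord cs w) :=
  (cs.exists_isReduced w).choose_spec.1

theorem wordProd_redWord (w : W) : cs.wordProd (redWord cs w) = w :=
  (cs.exists_isReduced w).choose_spec.2.symm

variable (φ) in
/-- Left multiplication by `T_s ⋯ T_t` for a word `s, …, t`. -/
def wordOp (ω : List B) : Module.End (GroupRing Γ) (Hecke cs φ) := (ω.map (leftOp φ)).prod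

theorem wordOp_rightOp (ω : List B) (i : B) (h : Hecke cs φ) :
    wordOp φ ω (rightOp φ i h) = rightOp φ i (wordOp φ ω h) := by
  induction ω with
  | nil => simp [wordOp]
  | cons j ω ih =>
    simp only [wordOp, List.map_cons, List.prod_cons, Module.End.mul_apply] at ih ⊢
    rw [ih, leftOp_rightOp]

theorem wordOp_T_one {ω : List B} (hω : cs.IsReduced ω) :
    wordOp φ ω (T φ 1) = T φ (cs.wordProd ω) := by
  induction ω with
  | nil => simp [wordOp]
  | cons j ω ih =>
    have hω' : cs.IsReduced ω := by simpa using hω.drop 1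
    have ih' := ih hω'
    simp only [wordOp, List.map_cons, List.prod_cons, Module.End.mul_apply] at ih' ⊢
    have e1 := hω.eq
    have e2 := hω'.eq
    rw [ih', leftOp_T, if_neg, zero_smul, add_zero, cs.wordProd_cons]
    rw [← cs.wordProd_cons, e1, e2]
    simp

variable (φ) in
/-- The multiplication of the Hecke algebra, as a map to the endomorphisms: `T_w` acts as the
product of the operators `T_s` along a reduced word of `w`. -/
def mulMap : Hecke cs φ →ₗ[GroupRing Γ] Module.End (GroupRing Γ) (Hecke cs φ) :=
  (T φ).constr (GroupRing Γ) fun w => wordOp φ (redWord cs w)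

theorem mulMap_T (w : W) : mulMap φ (T φ w) = wordOp φ (redWord cs w) :=
  Module.Basis.constr_basis _ _ _ _

theorem mulMap_rightOp (h k : Hecke cs φ) (i : B) :
    mulMap φ h (rightOp φ i k) = rightOp φ i (mulMap φ h k) := by
  induction h using hecke_induction with
  | zero => simp
  | add x y hx hy => simp [hx, hy]
  | smul a w => simp [mulMap_T, wordOp_rightOp]

theorem mulMap_T_one (h : Hecke cs φ) : mulMap φ h (T φ 1) = h := by
  induction h using hecke_induction with
  | zero => simp
  | add x y hx hy => simp [hx, hy]
  | smul a w =>
    simp [mulMap_T, wordOp_T_one (redWord_isReduced w), wordProd_redWord]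

theorem mulMap_eq {f : Module.End (GroupRing Γ) (Hecke cs φ)}
    (hf : ∀ i h, f (rightOp φ i h) = rightOp φ i (f h)) : mulMap φ (f (T φ 1)) = f :=
  hecke_ext (fun i h => mulMap_rightOp _ h i) hf (mulMap_T_one _)

theorem mulMap_mulMap (h k : Hecke cs φ) :
    mulMap φ (mulMap φ h k) = mulMap φ h * mulMap φ k := by
  have := mulMap_eq (φ := φ) (f := mulMap φ h * mulMap φ k) (fun i x => by
    simp only [Module.End.mul_apply, mulMap_rightOp])
  rwa [Module.End.mul_apply, mulMap_T_one] at this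

/-- The Hecke algebra is an associative ring with unit `T_1`. -/
instance : Ring (Hecke cs φ) :=
  { (inferInstance : AddCommGroup (Hecke cs φ)) with
    mul := fun h k => mulMap φ h k
    one := T φ 1
    left_distrib := fun h k l => map_add (mulMap φ h) k l
    right_distrib := fun h k l => by
      change mulMap φ (h + k) l = mulMap φ h l + mulMap φ k l
      rw [map_add, LinearMap.add_apply]
    zero_mul := fun h => by
      change mulMap φ 0 h = 0
      rw [map_zero, LinearMap.zero_apply]
    mul_zero := fun h => map_zero (mulMap φ h)
    mul_assoc := fun h k l => by
      change mulMap φ (mulMap φ h k) l = mulMap φ h (mulMap φ k l)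
      rw [mulMap_mulMap, Module.End.mul_apply]
    one_mul := fun h => by
      change mulMap φ (T φ 1) h = h
      rw [show T φ 1 = (1 : Module.End (GroupRing Γ) (Hecke cs φ)) (T φ 1) from rfl,
        mulMap_eq (fun _ _ => rfl), Module.End.one_apply]
    mul_one := fun h => mulMap_T_one h }

theorem mul_def (h k : Hecke cs φ) : h * k = mulMap φ h k := rfl

theorem T_one : T φ 1 = (1 : Hecke cs φ) := rfl

/-- The Hecke algebra is an algebra over `ℤ[Γ]`. -/
instance : Algebra (GroupRing Γ) (Hecke cs φ) :=
  Algebra.ofModule (fun a h k => by simp [mul_def]) (fun a h k => by simp [mul_def])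

theorem T_simple_mul (i : B) (h : Hecke cs φ) : T φ (cs.simple i) * h = leftOp φ i h := by
  have h1 : leftOp φ i (T φ 1) = T φ (cs.simple i) := by simp [leftOp_T]
  rw [mul_def, ← h1, mulMap_eq fun j k => leftOp_rightOp i j k]

/-- `T_w T_v = T_{wv}` if the lengths add up. -/
theorem T_mul_T {w v : W} (h : cs.length (w * v) = cs.length w + cs.length v) :
    T φ w * T φ v = T φ (w * v) := by
  induction hn : cs.length w generalizing w with
  | zero =>
    rw [cs.length_eq_zero_iff.1 hn, T_one, one_mul, one_mul]
  | succ n ih =>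
    obtain ⟨i, hi⟩ := cs.exists_leftDescent_of_ne_one (w := w) (by
      rintro rfl
      simp at hn)
    have hlen := cs.isLeftDescent_iff.1 hi
    have h3 := cs.length_mul_le (cs.simple i * w) v
    have h4 := cs.length_simple_mul (w * v) i
    rw [mul_assoc] at h3
    have ih' := ih (w := cs.simple i * w) (by rw [mul_assoc]; omega) (by omega)
    have hT : ∀ u : W, cs.length (cs.simple i * u) + 1 = cs.length u →
        T φ u = T φ (cs.simple i) * T φ (cs.simple i * u) := by
      intro u hu
      rw [T_simple_mul, leftOp_T, if_neg]
      · simp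
      · simp only [cs.simple_mul_simple_cancel_left]
        omega
    rw [hT w hlen, mul_assoc, ih', mul_assoc, ← hT (w * v) (by omega)]

/-- The quadratic relation. -/
theorem T_quadratic (i : B) :
    (T φ (cs.simple i) - algebraMap _ _ (expo (φ (simpleClass cs i)))) *
      (T φ (cs.simple i) + algebraMap _ _ (expo (-φ (simpleClass cs i)))) = 0 := by
  have h1 : T φ (cs.simple i) * T φ (cs.simple i) = 1 + xi φ i • T φ (cs.simple i) := by
    rw [T_simple_mul, leftOp_T]
    simp [T_one]
  have h2 : expo (φ (simpleClass cs i)) * expo (-φ (simpleClass cs i)) = 1 := by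
    rw [expo_mul_expo, add_neg_cancel, expo_zero]
  rw [sub_mul, mul_add, mul_add, h1, ← map_mul, h2, map_one, ← Algebra.commutes, ← Algebra.smul_def,
    ← Algebra.smul_def, xi, sub_smul]
  abel

end Algebra

section Semilinear

variable {B W : Type*} [Group W] {M : CoxeterMatrix B} {cs : CoxeterSystem M W}
variable {Γ Γ' : Type*} [AddCommGroup Γ] [AddCommGroup Γ']
variable {φ : SimpleClass cs → Γ} {φ' : SimpleClass cs → Γ'}

variable (φ) in
/-- The semilinear map sending `T_w` to `v w`. -/
def semiConstr (σ : GroupRing Γ →+* GroupRing Γ') (v : W → Hecke cs φ') :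
    Hecke cs φ →ₛₗ[σ] Hecke cs φ' where
  toFun h := ((T φ).repr h).sum fun w a => σ a • v w
  map_add' h k := by
    rw [map_add, Finsupp.sum_add_index']
    · simp
    · intro w a b; rw [map_add, add_smul]
  map_smul' a h := by
    rw [map_smul, Finsupp.sum_smul_index, Finsupp.smul_sum]
    · simp [mul_smul]
    · simp

theorem semiConstr_T (σ : GroupRing Γ →+* GroupRing Γ') (v : W → Hecke cs φ') (w : W) :
    semiConstr φ σ v (T φ w) = v w := by
  change ((T φ).repr (T φ w)).sum (fun w a => σ a • v w) = v w
  rw [Module.Basis.repr_self, Finsupp.sum_single_index] <;> simp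

variable (φ) in
/-- The bar involution: the antilinear map sending `T_w` to the inverse of `T_{w⁻¹}`. The elements
`T_w` are invertible, see `isUnit_T`. -/
def bar : Hecke cs φ →ₛₗ[barCoeff Γ] Hecke cs φ :=
  semiConstr φ (barCoeff Γ) fun w => Ring.inverse (T φ w⁻¹)

variable (φ) in
/-- The map `ρ_*` induced by a morphism `ρ : Γ → Γ'`: the semilinear map sending `T_w` to
`T_w`. -/
def pushforward (ρ : Γ →+ Γ') : Hecke cs φ →ₛₗ[groupRingMap ρ] Hecke cs (ρ ∘ φ) :=
  semiConstr φ (groupRingMap ρ) fun w => T (ρ ∘ φ) w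

end Semilinear

section Bar

variable {B W : Type*} [Group W] {M : CoxeterMatrix B} {cs : CoxeterSystem M W}
variable {Γ : Type*} [AddCommGroup Γ] {φ : SimpleClass cs → Γ}

theorem T_simple_sq (i : B) :
    T φ (cs.simple i) * T φ (cs.simple i) = 1 + xi φ i • T φ (cs.simple i) := by
  rw [T_simple_mul, leftOp_T]
  simp [T_one]

variable (φ) in
/-- `T_s` as a unit of the Hecke algebra. -/
def unitT (i : B) : (Hecke cs φ)ˣ where
  val := T φ (cs.simple i)
  inv := T φ (cs.simple i) - xi φ i • 1
  val_inv := by rw [mul_sub, T_simple_sq]; simp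
  inv_val := by rw [sub_mul, T_simple_sq]; simp

theorem isUnit_T (w : W) : IsUnit (T φ w) := by
  induction hn : cs.length w generalizing w with
  | zero => rw [cs.length_eq_zero_iff.1 hn, T_one]; exact isUnit_one
  | succ n ih =>
    obtain ⟨i, hi⟩ := cs.exists_leftDescent_of_ne_one (w := w) (by
      rintro rfl
      simp at hn)
    have hlen := cs.isLeftDescent_iff.1 hi
    have := T_mul_T (φ := φ) (w := cs.simple i) (v := cs.simple i * w) (by
      rw [cs.simple_mul_simple_cancel_left, cs.length_simple]; omega)
    rw [cs.simple_mul_simple_cancel_left] at this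
    rw [← this]
    exact (unitT φ i).isUnit.mul (ih _ (by omega))

theorem bar_T (w : W) : bar φ (T φ w) = Ring.inverse (T φ w⁻¹) := semiConstr_T _ _ _

theorem bar_T_one : bar φ (T φ 1) = T φ 1 := by
  rw [bar_T, inv_one, T_one, Ring.inverse_one]

theorem bar_T_simple (i : B) : bar φ (T φ (cs.simple i)) = T φ (cs.simple i) - xi φ i • 1 := by
  rw [bar_T, cs.inv_simple]
  exact Ring.inverse_unit (unitT φ i)

theorem bar_xi (i : B) : barCoeff Γ (xi φ i) = -xi φ i := by
  rw [xi, map_sub, groupRingMap_expo, groupRingMap_expo]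
  simp

theorem bar_T_mul_of_lt {i : B} {w : W} (h : cs.length w < cs.length (cs.simple i * w)) :
    bar φ (T φ (cs.simple i * w)) = bar φ (T φ (cs.simple i)) * bar φ (T φ w) := by
  rw [bar_T, bar_T, bar_T, mul_inv_rev]
  have h1 := cs.length_simple_mul w i
  have h2 : T φ w⁻¹ * T φ (cs.simple i)⁻¹ = T φ (w⁻¹ * (cs.simple i)⁻¹) := T_mul_T (by
    rw [← mul_inv_rev, cs.length_inv, cs.length_inv, cs.length_inv, cs.length_simple]
    omega)
  rw [← h2]
  obtain ⟨u, hu⟩ := isUnit_T (φ := φ) w⁻¹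
  obtain ⟨v, hv⟩ := isUnit_T (φ := φ) (cs.simple i)⁻¹
  rw [← hu, ← hv, ← Units.val_mul, Ring.inverse_unit, Ring.inverse_unit, Ring.inverse_unit,
    mul_inv_rev, Units.val_mul]

theorem bar_T_simple_mul (i : B) (h : Hecke cs φ) :
    bar φ (T φ (cs.simple i) * h) = bar φ (T φ (cs.simple i)) * bar φ h := by
  induction h using hecke_induction with
  | zero => simp
  | add x y hx hy => rw [mul_add, map_add, hx, hy, map_add, mul_add]
  | smul a w =>
    rw [mul_smul_comm, map_smulₛₗ, map_smulₛₗ, mul_smul_comm]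
    congr 1
    rw [T_simple_mul, leftOp_T]
    split_ifs with hw
    · have h1 := bar_T_mul_of_lt (φ := φ) (i := i) (w := cs.simple i * w) (by simpa using hw)
      rw [cs.simple_mul_simple_cancel_left] at h1
      rw [map_add, map_smulₛₗ, bar_xi, h1]
      have h2 : T φ (cs.simple i) = bar φ (T φ (cs.simple i)) + xi φ i • 1 := by
        rw [bar_T_simple]; abel
      have h3 : T φ (cs.simple i) * (bar φ (T φ (cs.simple i)) * bar φ (T φ (cs.simple i * w))) =
          bar φ (T φ (cs.simple i * w)) := by
        rw [bar_T_simple]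
        exact (unitT φ i).mul_inv_cancel_left _
      rw [← sub_eq_zero]
      nth_rewrite 1 [← h3]
      nth_rewrite 1 [h2]
      rw [add_mul, smul_mul_assoc, one_mul, neg_smul]
      abel
    · rw [zero_smul, add_zero]
      apply bar_T_mul_of_lt
      have := cs.length_simple_mul_ne w i
      omega

theorem barCoeff_barCoeff (a : GroupRing Γ) : barCoeff Γ (barCoeff Γ a) = a := by
  rw [← RingHom.comp_apply, barCoeff, groupRingMap, ← AddMonoidAlgebra.mapDomainRingHom_comp]
  have : (negAddMonoidHom : Γ →+ Γ).comp negAddMonoidHom = AddMonoidHom.id Γ := by ext; simp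
  rw [this]
  simp

theorem bar_bar (h : Hecke cs φ) : bar φ (bar φ h) = h := by
  induction h using hecke_induction with
  | zero => simp
  | add x y hx hy => rw [map_add, map_add, hx, hy]
  | smul a w =>
    rw [map_smulₛₗ, map_smulₛₗ, barCoeff_barCoeff]
    congr 1
    induction hn : cs.length w generalizing w with
    | zero => rw [cs.length_eq_zero_iff.1 hn, bar_T_one, bar_T_one]
    | succ n ih =>
      obtain ⟨i, hi⟩ := cs.exists_leftDescent_of_ne_one (w := w) (by
        rintro rfl
        simp at hn)
      have hlen := cs.isLeftDescent_iff.1 hi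
      have h1 : T φ (cs.simple i) * T φ (cs.simple i * w) = T φ w := by
        rw [T_mul_T, cs.simple_mul_simple_cancel_left]
        rw [cs.simple_mul_simple_cancel_left, cs.length_simple]; omega
      rw [← h1, bar_T_simple_mul, bar_T_simple, sub_mul, map_sub, bar_T_simple_mul,
        smul_mul_assoc, one_mul, map_smulₛₗ, bar_xi, ih _ (by omega), bar_T_simple, sub_mul,
        smul_mul_assoc, one_mul]
      simp

/-- The elements supported on elements of `W` of length smaller than `n`. -/
def lower (cs : CoxeterSystem M W) (φ : SimpleClass cs → Γ) (n : ℕ) :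
    Submodule (GroupRing Γ) (Hecke cs φ) where
  carrier := {h | ∀ w, n ≤ cs.length w → (T φ).repr h w = 0}
  zero_mem' := by simp
  add_mem' {x y} hx hy w hw := by simp [hx w hw, hy w hw]
  smul_mem' a x hx w hw := by simp [hx w hw]

theorem mem_lower {n : ℕ} {h : Hecke cs φ} :
    h ∈ lower cs φ n ↔ ∀ w, n ≤ cs.length w → (T φ).repr h w = 0 := Iff.rfl

theorem lower_mono {m n : ℕ} (h : m ≤ n) : lower cs φ m ≤ lower cs φ n :=
  fun _ hx w hw => hx w (h.trans hw)

theorem T_mem_lower {n : ℕ} {w : W} (h : cs.length w < n) : T φ w ∈ lower cs φ n := by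
  intro v hv
  rw [Module.Basis.repr_self, Finsupp.single_eq_of_ne]
  rintro rfl
  omega

theorem exists_mem_lower (h : Hecke cs φ) : ∃ n, h ∈ lower cs φ n := by
  refine ⟨(((T φ).repr h).support.sup cs.length) + 1, fun w hw => ?_⟩
  by_contra h0
  have := Finset.le_sup (f := cs.length) (Finsupp.mem_support_iff.2 h0)
  omega

@[elab_as_elim]
theorem lower_induction {n : ℕ} {p : Hecke cs φ → Prop} {h : Hecke cs φ} (hh : h ∈ lower cs φ n)
    (zero : p 0) (add : ∀ x y, p x → p y → p (x + y))
    (smul : ∀ (a : GroupRing Γ) (w : W), cs.length w < n → p (a • T φ w)) : p h := by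
  rw [← (T φ).linearCombination_repr h, Finsupp.linearCombination_apply, Finsupp.sum]
  refine Finset.sum_induction _ p add zero fun w hw => smul _ _ ?_
  by_contra hn
  exact Finsupp.mem_support_iff.1 hw (hh w (not_lt.1 hn))

theorem leftOp_mem_lower {n : ℕ} {h : Hecke cs φ} (hh : h ∈ lower cs φ n) (i : B) :
    leftOp φ i h ∈ lower cs φ (n + 1) := by
  refine lower_induction hh ?_ (fun x y hx hy => ?_) (fun a w hw => ?_)
  · simp
  · rw [map_add]; exact add_mem hx hy
  · rw [map_smul, leftOp_T]
    have := cs.length_simple_mul w i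
    exact Submodule.smul_mem _ _ (add_mem (T_mem_lower (by omega))
      (Submodule.smul_mem _ _ (T_mem_lower (by omega))))

theorem bar_T_sub_mem (w : W) : bar φ (T φ w) - T φ w ∈ lower cs φ (cs.length w) := by
  induction hn : cs.length w generalizing w with
  | zero => rw [cs.length_eq_zero_iff.1 hn, bar_T_one, sub_self]; exact zero_mem _
  | succ n ih =>
    obtain ⟨i, hi⟩ := cs.exists_leftDescent_of_ne_one (w := w) (by
      rintro rfl
      simp at hn)
    have hlen := cs.isLeftDescent_iff.1 hi
    have h1 : T φ (cs.simple i) * T φ (cs.simple i * w) = T φ w := by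
      rw [T_mul_T, cs.simple_mul_simple_cancel_left]
      rw [cs.simple_mul_simple_cancel_left, cs.length_simple]; omega
    have h2 := ih (cs.simple i * w) (by omega)
    have h3 : bar φ (T φ w) - T φ w = leftOp φ i (bar φ (T φ (cs.simple i * w)) -
        T φ (cs.simple i * w)) - xi φ i • (bar φ (T φ (cs.simple i * w)) -
        T φ (cs.simple i * w)) - xi φ i • T φ (cs.simple i * w) := by
      rw [← h1, bar_T_simple_mul, ← T_simple_mul, bar_T_simple, sub_mul, smul_mul_assoc, one_mul,
        mul_sub, smul_sub]
      abel
    rw [h3]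
    exact sub_mem (sub_mem (leftOp_mem_lower h2 i) (Submodule.smul_mem _ _
      (lower_mono (by omega) h2))) (Submodule.smul_mem _ _ (T_mem_lower (by omega)))

theorem bar_mem_lower {n : ℕ} {h : Hecke cs φ} (hh : h ∈ lower cs φ n) :
    bar φ h ∈ lower cs φ n := by
  refine lower_induction hh ?_ (fun x y hx hy => ?_) (fun a w hw => ?_)
  · simp
  · rw [map_add]; exact add_mem hx hy
  · rw [map_smulₛₗ]
    refine Submodule.smul_mem _ _ ?_
    rw [← sub_add_cancel (bar φ (T φ w)) (T φ w)]
    exact add_mem (lower_mono hw.le (bar_T_sub_mem w)) (T_mem_lower hw)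

/-- On coefficients of maximal length, the bar involution acts by `barCoeff`. -/
theorem repr_bar {n : ℕ} {h : Hecke cs φ} (hh : h ∈ lower cs φ (n + 1)) (w : W)
    (hw : n ≤ cs.length w) :
    (T φ).repr (bar φ h) w = barCoeff Γ ((T φ).repr h w) := by
  refine lower_induction hh ?_ (fun x y hx hy => ?_) (fun a v hv => ?_)
  · simp
  · simp only [map_add, Finsupp.add_apply, hx, hy]
  · have h1 := bar_T_sub_mem (φ := φ) v w (by omega)
    rw [map_sub, Finsupp.sub_apply, sub_eq_zero] at h1
    rw [map_smulₛₗ, map_smul, Finsupp.smul_apply, h1, map_smul, Finsupp.smul_apply, smul_eq_mul,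
      smul_eq_mul, map_mul]
    congr 1
    rw [Module.Basis.repr_self]
    classical
    rw [Finsupp.single_apply]
    split_ifs
    · exact (map_one _).symm
    · exact (map_zero _).symm

theorem coeff_barCoeff (a : GroupRing Γ) (γ : Γ) : (barCoeff Γ a).coeff γ = a.coeff (-γ) := by
  have := Finsupp.mapDomain_apply (f := fun x : Γ => -x) neg_injective a.coeff (-γ)
  rwa [neg_neg] at this

end Bar

section KL

variable {B W : Type*} [Group W] {M : CoxeterMatrix B} {cs : CoxeterSystem M W}
variable {Γ : Type*} [AddCommGroup Γ] [LinearOrder Γ]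
variable {φ : SimpleClass cs → Γ}

/-- The subgroup `ℤ[Γ_{<0}]` of `ℤ[Γ]`. -/
def negCoeff (Γ : Type*) [AddCommGroup Γ] [LinearOrder Γ] : AddSubgroup (GroupRing Γ) where
  carrier := {a | ∀ γ, 0 ≤ γ → a.coeff γ = 0}
  zero_mem' := by simp
  add_mem' {a b} ha hb γ hγ := by simp [ha γ hγ, hb γ hγ]
  neg_mem' {a} ha γ hγ := by simp [ha γ hγ]

/-- The subgroup `⨁_w ℤ[Γ_{<0}] T_w` of the Hecke algebra. -/
def heckeNeg (cs : CoxeterSystem M W) (φ : SimpleClass cs → Γ) : AddSubgroup (Hecke cs φ) where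
  carrier := {h | ∀ w, (T φ).repr h w ∈ negCoeff Γ}
  zero_mem' w := by simp [zero_mem]
  add_mem' {x y} hx hy w := by simpa using add_mem (hx w) (hy w)
  neg_mem' {x} hx w := by simpa using neg_mem (hx w)

theorem mem_heckeNeg {h : Hecke cs φ} :
    h ∈ heckeNeg cs φ ↔ ∀ w, (T φ).repr h w ∈ negCoeff Γ := Iff.rfl

open Classical in
/-- The part of an element of `ℤ[Γ]` supported on negative elements. -/
def negPart (a : GroupRing Γ) : GroupRing Γ :=
  AddMonoidAlgebra.ofCoeff (a.coeff.filter (· < 0))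

theorem negPart_zero : negPart (0 : GroupRing Γ) = 0 := by
  ext γ
  simp [negPart, Finsupp.filter_apply]

theorem negPart_mem (a : GroupRing Γ) : negPart a ∈ negCoeff Γ := fun γ hγ => by
  simp [negPart, not_lt.2 hγ]

variable [IsOrderedAddMonoid Γ]

theorem eq_zero_of_negCoeff {a : GroupRing Γ} (ha : a ∈ negCoeff Γ) (h : barCoeff Γ a = a) :
    a = 0 := by
  ext γ
  rcases le_total 0 γ with hγ | hγ
  · exact ha γ hγ
  · rw [← h, coeff_barCoeff]
    exact ha _ (neg_nonneg.2 hγ)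

theorem negPart_sub (a : GroupRing Γ) (h : barCoeff Γ a = -a) :
    negPart a - barCoeff Γ (negPart a) = a := by
  ext γ
  have h1 : a.coeff (-γ) = -a.coeff γ := by
    rw [← coeff_barCoeff, h]; rfl
  change (negPart a).coeff γ - (barCoeff Γ (negPart a)).coeff γ = a.coeff γ
  rw [coeff_barCoeff]
  classical
  simp only [negPart, Finsupp.filter_apply, Left.neg_neg_iff, h1]
  rcases lt_trichotomy γ 0 with hγ | hγ | hγ
  · simp [hγ, hγ.le]
  · subst hγ
    rw [neg_zero] at h1
    simp
    omega
  · simp [hγ, hγ.le]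

theorem eq_zero_of_bar_eq {h : Hecke cs φ} (hneg : h ∈ heckeNeg cs φ) (hbar : bar φ h = h) :
    h = 0 := by
  obtain ⟨n, hn⟩ := exists_mem_lower h
  induction n with
  | zero => exact (T φ).repr.map_eq_zero_iff.1 (Finsupp.ext fun w => hn w (Nat.zero_le _))
  | succ n ih =>
    refine ih fun w hw => ?_
    refine eq_zero_of_negCoeff (hneg w) ?_
    rw [← repr_bar hn w hw, hbar]

theorem exists_sub_bar {n : ℕ} {r : Hecke cs φ} (hr : r ∈ lower cs φ n) (hbar : bar φ r = -r) :
    ∃ a ∈ lower cs φ n, a ∈ heckeNeg cs φ ∧ a - bar φ a = r := by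
  induction n generalizing r with
  | zero =>
    refine ⟨0, zero_mem _, zero_mem _, ?_⟩
    rw [map_zero, sub_zero]
    exact ((T φ).repr.map_eq_zero_iff.1 (Finsupp.ext fun w => hr w (Nat.zero_le _))).symm
  | succ n ih =>
    classical
    set a : Hecke cs φ := (T φ).repr.symm
      ((((T φ).repr r).filter fun w => n ≤ cs.length w).mapRange negPart negPart_zero) with ha
    have ha1 : ∀ w, (T φ).repr a w = if n ≤ cs.length w then negPart ((T φ).repr r w) else 0 := by
      intro w
      rw [ha, LinearEquiv.apply_symm_apply, Finsupp.mapRange_apply, Finsupp.filter_apply]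
      split_ifs
      · rfl
      · exact negPart_zero
    have ha2 : a ∈ lower cs φ (n + 1) := by
      intro w hw
      rw [ha1, if_pos (by omega), hr w hw, negPart_zero]
    have ha3 : a ∈ heckeNeg cs φ := by
      intro w
      rw [ha1]
      split_ifs
      · exact negPart_mem _
      · exact zero_mem _
    have h4 : r - (a - bar φ a) ∈ lower cs φ n := by
      intro w hw
      have h5 := repr_bar hr w hw
      rw [hbar, map_neg, Finsupp.neg_apply] at h5
      rw [map_sub, map_sub, Finsupp.sub_apply, Finsupp.sub_apply, repr_bar ha2 w hw, ha1,
        if_pos hw, negPart_sub _ h5.symm, sub_self]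
    obtain ⟨b, hb1, hb2, hb3⟩ := ih h4 (by
      rw [map_sub, map_sub, bar_bar, hbar]; abel)
    refine ⟨a + b, add_mem ha2 (lower_mono (Nat.le_succ n) hb1), add_mem ha3 hb2, ?_⟩
    rw [map_add, add_sub_add_comm, hb3]
    abel

variable (φ) in
/-- The existence and the uniqueness of the Kazhdan-Lusztig element of `w`. -/
theorem existsUnique_C (w : W) :
    ∃! c : Hecke cs φ, bar φ c = c ∧ c - T φ w ∈ heckeNeg cs φ := by
  obtain ⟨a, -, ha2, ha3⟩ := exists_sub_bar (bar_T_sub_mem (φ := φ) w) (by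
    rw [map_sub, bar_bar]; abel)
  refine ⟨T φ w + a, ⟨?_, by simpa using ha2⟩, ?_⟩
  · rw [map_add, ← sub_eq_zero]
    rw [sub_eq_iff_eq_add] at ha3
    nth_rewrite 2 [ha3]
    abel
  · rintro c ⟨hc1, hc2⟩
    have hb : bar φ (T φ w + a) = T φ w + a := by
      rw [map_add, ← sub_eq_zero]
      rw [sub_eq_iff_eq_add] at ha3
      nth_rewrite 2 [ha3]
      abel
    refine sub_eq_zero.1 (eq_zero_of_bar_eq ?_ (by rw [map_sub, hc1, hb]))
    have : c - (T φ w + a) = (c - T φ w) - a := by abel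
    rw [this]
    exact sub_mem hc2 ha2

variable (φ) in
/-- The Kazhdan-Lusztig element `C_w`: the unique bar invariant element of the Hecke algebra
congruent to `T_w` modulo `heckeNeg`. -/
def C (w : W) : Hecke cs φ := (existsUnique_C φ w).choose

theorem bar_C (w : W) : bar φ (C φ w) = C φ w := (existsUnique_C φ w).choose_spec.1.1

theorem C_sub_T_mem (w : W) : C φ w - T φ w ∈ heckeNeg cs φ :=
  (existsUnique_C φ w).choose_spec.1.2

theorem eq_C {w : W} {c : Hecke cs φ} (h1 : bar φ c = c) (h2 : c - T φ w ∈ heckeNeg cs φ) :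
    c = C φ w := (existsUnique_C φ w).choose_spec.2 c ⟨h1, h2⟩

theorem C_sub_T_mem_lower (w : W) : C φ w - T φ w ∈ lower cs φ (cs.length w) := by
  obtain ⟨a, ha1, ha2, ha3⟩ := exists_sub_bar (bar_T_sub_mem (φ := φ) w) (by
    rw [map_sub, bar_bar]; abel)
  have : T φ w + a = C φ w := by
    refine eq_C ?_ (by simpa using ha2)
    rw [map_add, ← sub_eq_zero]
    rw [sub_eq_iff_eq_add] at ha3
    nth_rewrite 2 [ha3]
    abel
  rw [← this]
  simpa using ha1

variable (φ) in
/-- The linear map sending `T_w` to `C_w`. -/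
def toC : Module.End (GroupRing Γ) (Hecke cs φ) := (T φ).constr (GroupRing Γ) (C φ)

theorem toC_T (w : W) : toC φ (T φ w) = C φ w := Module.Basis.constr_basis _ _ _ _

theorem toC_sub_mem {n : ℕ} {h : Hecke cs φ} (hh : h ∈ lower cs φ (n + 1)) :
    toC φ h - h ∈ lower cs φ n := by
  refine lower_induction hh ?_ (fun x y hx hy => ?_) (fun a w hw => ?_)
  · simp
  · rw [map_add, add_sub_add_comm]; exact add_mem hx hy
  · rw [map_smul, toC_T, ← smul_sub]
    exact Submodule.smul_mem _ _ (lower_mono (by omega) (C_sub_T_mem_lower w))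

theorem toC_bijective : Function.Bijective (toC (cs := cs) φ) := by
  constructor
  · rw [← LinearMap.ker_eq_bot, LinearMap.ker_eq_bot']
    intro h h0
    obtain ⟨n, hn⟩ := exists_mem_lower h
    induction n with
    | zero => exact (T φ).repr.map_eq_zero_iff.1 (Finsupp.ext fun w => hn w (Nat.zero_le _))
    | succ n ih =>
      have := toC_sub_mem hn
      rw [h0, zero_sub] at this
      exact ih (neg_mem_iff.1 this)
  · intro h
    obtain ⟨n, hn⟩ := exists_mem_lower h
    induction n generalizing h with
    | zero =>
      exact ⟨0, by rw [map_zero]; exact ((T φ).repr.map_eq_zero_iff.1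
        (Finsupp.ext fun w => hn w (Nat.zero_le _))).symm⟩
    | succ n ih =>
      obtain ⟨x, hx⟩ := ih _ (toC_sub_mem hn)
      exact ⟨h - x, by rw [map_sub, hx]; abel⟩

variable (φ) in
/-- The Kazhdan-Lusztig basis `(C_w)`. -/
def basisC : Module.Basis W (GroupRing Γ) (Hecke cs φ) :=
  (T φ).map (LinearEquiv.ofBijective (toC φ) toC_bijective)

theorem basisC_apply (w : W) : basisC φ w = C φ w := toC_T w

end KL

section Cells

/-- The three sides: left, right, two-sided. -/
inductive Side
  | L
  | R
  | LR

variable {B W : Type*} [Group W] {M : CoxeterMatrix B} {cs : CoxeterSystem M W}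
variable {Γ : Type*} [AddCommGroup Γ] [LinearOrder Γ] [IsOrderedAddMonoid Γ]

/-- The relation `x ← y`: the coefficient of `C_x` is nonzero in `h C_y` (left), in `C_y h` (right),
or in one of them (two-sided), for some element `h` of the Hecke algebra. -/
def Arrow (φ : SimpleClass cs → Γ) : Side → W → W → Prop
  | .L, x, y => ∃ h : Hecke cs φ, (basisC φ).repr (h * C φ y) x ≠ 0
  | .R, x, y => ∃ h : Hecke cs φ, (basisC φ).repr (C φ y * h) x ≠ 0
  | .LR, x, y => ∃ h : Hecke cs φ,
      (basisC φ).repr (h * C φ y) x ≠ 0 ∨ (basisC φ).repr (C φ y * h) x ≠ 0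

/-- The preorder `x ≤ y`, the transitive closure of the relation `x ← y`. -/
def CellLE (φ : SimpleClass cs → Γ) (d : Side) : W → W → Prop := Relation.TransGen (Arrow φ d)

/-- The equivalence relation associated with the preorder. -/
def CellEquiv (φ : SimpleClass cs → Γ) (d : Side) (x y : W) : Prop :=
  CellLE φ d x y ∧ CellLE φ d y x

/-- The cell of `w`. -/
def Cell (φ : SimpleClass cs → Γ) (d : Side) (w : W) : Set W := {x | CellEquiv φ d x w}

end Cells

end HeckeKL
end

noncomputable section

namespace HeckeKL

/-! ### Compatibility of `ρ_*` with the product and the bar involution (no order involved). -/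

section Pushforward

variable {B W : Type*} [Group W] {M : CoxeterMatrix B} {cs : CoxeterSystem M W}
variable {Γ Γ' : Type*} [AddCommGroup Γ] [AddCommGroup Γ']
variable {φ : SimpleClass cs → Γ} {ρ : Γ →+ Γ'}

/-! The parameter enters the Hecke algebra only through the elements `xi φ i` of the group ring, and
the morphism `ℤ[Γ] → ℤ[Γ']` sends `xi φ i` to `xi (ρ ∘ φ) i`. Lengths and reduced words live in `W`
and do not change. Hence `ρ_*` is multiplicative (`pushforward_mul`) and commutes with the bar
involutions (`pushforward_bar`), for any morphism `ρ`. It acts on coordinates in the bases `(T_w)`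
by the ring morphism, which is injective when `ρ` is; this gives (a).

The order is needed for (b): a strictly increasing `ρ` sends negative elements to negative elements,
so `ρ_*(C_w)` is bar invariant and congruent to `T_w` modulo negative coefficients. Uniqueness of
the Kazhdan-Lusztig element makes it `C_w` for the parameter `ρ ∘ φ` (`pushforward_C`).

For (c) and (d), `ρ_*` now sends one basis `(C_w)` to the other, so by injectivity on scalars it
neither creates nor kills a coefficient in it. This transports an arrow `x ← y` from `φ` to `ρ ∘ φ`.
The converse needs an argument, since `ρ_*` need not be surjective: the coefficient of `C_x` in `h
C_y` is linear in `h`, so if it is nonzero for some `h` it is nonzero for some `T_w`, and `T_w` is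
in the image of `ρ_*` (`exists_repr_mul_ne_zero_iff` and its mirror image). So the arrows already
coincide, and with them the preorders, the equivalences and the cells. -/

theorem groupRingMap_injective (hρ : Function.Injective ρ) :
    Function.Injective (groupRingMap ρ) := AddMonoidAlgebra.mapDomain_injective hρ

/-- A semilinear map sending a basis to a basis acts coefficientwise. -/
theorem basis_repr_semilinear {R S ι M N : Type*} [Semiring R] [Semiring S] {σ : R →+* S}
    [AddCommMonoid M] [AddCommMonoid N] [Module R M] [Module S N] (b : Module.Basis ι R M)
    (c : Module.Basis ι S N) (f : M →ₛₗ[σ] N) (hf : ∀ i, f (b i) = c i) (x : M) (i : ι) :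
    c.repr (f x) i = σ (b.repr x i) := by
  classical
  -- Passing to coordinates allows induction on a finitely supported function.
  obtain ⟨l, rfl⟩ := b.repr.symm.surjective x
  rw [LinearEquiv.apply_symm_apply]
  induction l using Finsupp.induction_linear with
  | zero => simp
  | add x y hx hy => simp only [map_add, Finsupp.add_apply, hx, hy]
  | single j a =>
    rw [Module.Basis.repr_symm_single, map_smulₛₗ, hf, map_smul, Finsupp.smul_apply,
      Module.Basis.repr_self, Finsupp.single_apply, Finsupp.single_apply]
    split_ifs <;> simp

/-- A linear map which is nonzero somewhere is nonzero at some `T_w`. -/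
theorem exists_T_ne_zero {N : Type*} [AddCommMonoid N] [Module (GroupRing Γ) N]
    (f : Hecke cs φ →ₗ[GroupRing Γ] N) {h : Hecke cs φ} (hf : f h ≠ 0) :
    ∃ w, f (T φ w) ≠ 0 := by
  by_contra! h0
  exact hf (LinearMap.congr_fun ((T φ).ext (f₂ := 0) h0) h)

theorem pushforward_T (w : W) : pushforward φ ρ (T φ w) = T (ρ ∘ φ) w := semiConstr_T _ _ _

theorem repr_pushforward (h : Hecke cs φ) (w : W) :
    (T (ρ ∘ φ)).repr (pushforward φ ρ h) w = groupRingMap ρ ((T φ).repr h w) :=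
  basis_repr_semilinear _ _ _ pushforward_T h w

theorem pushforward_injective (hρ : Function.Injective ρ) :
    Function.Injective (pushforward φ ρ) := by
  intro h k hhk
  refine (T φ).ext_elem fun w => groupRingMap_injective hρ ?_
  rw [← repr_pushforward, ← repr_pushforward, hhk]

theorem groupRingMap_xi (i : B) : groupRingMap ρ (xi φ i) = xi (ρ ∘ φ) i := by
  rw [xi, xi, map_sub, groupRingMap_expo, groupRingMap_expo, map_neg]
  rfl

/-- Both composites are induced by the same morphism of groups, because `ρ (-γ) = -ρ γ`. -/
theorem groupRingMap_barCoeff (a : GroupRing Γ) :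
    groupRingMap ρ (barCoeff Γ a) = barCoeff Γ' (groupRingMap ρ a) := by
  rw [← RingHom.comp_apply, ← RingHom.comp_apply, ← AddMonoidAlgebra.mapDomainRingHom_comp,
    ← AddMonoidAlgebra.mapDomainRingHom_comp]
  have : ρ.comp negAddMonoidHom = negAddMonoidHom.comp ρ := by ext; simp
  rw [this]

/-- On `T_w`, the matrix entries of `leftOp` are `0`, `1` and `xi`, chosen by comparing lengths in
`W`, independently of the parameter; only `xi` has to be transported. -/
theorem pushforward_leftOp (i : B) (h : Hecke cs φ) :
    pushforward φ ρ (leftOp φ i h) = leftOp (ρ ∘ φ) i (pushforward φ ρ h) := by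
  induction h using hecke_induction with
  | zero => simp
  | add x y hx hy => simp only [map_add, hx, hy]
  | smul a w =>
    rw [map_smul, map_smulₛₗ, map_smulₛₗ, map_smul, leftOp_T, map_add, map_smulₛₗ, pushforward_T,
      pushforward_T, leftOp_T]
    split_ifs
    · rw [groupRingMap_xi]
    · rw [map_zero]

theorem pushforward_one : pushforward φ ρ (1 : Hecke cs φ) = 1 := pushforward_T 1

/-- Induction on the length: a property of `T_w` holds for all `w` if it holds for `1` and passes
from `T_w` to `T_s T_w`. -/
theorem T_induction {p : Hecke cs φ → Prop} (w : W) (one : p 1)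
    (mul : ∀ (i : B) (v : W), p (T φ v) → p (T φ (cs.simple i) * T φ v)) : p (T φ w) := by
  induction hn : cs.length w generalizing w with
  | zero => rwa [cs.length_eq_zero_iff.1 hn, T_one]
  | succ n ih =>
    obtain ⟨i, hi⟩ := cs.exists_leftDescent_of_ne_one (w := w) (by
      rintro rfl
      simp at hn)
    have hlen := cs.isLeftDescent_iff.1 hi
    have h1 : T φ (cs.simple i) * T φ (cs.simple i * w) = T φ w := by
      rw [T_mul_T, cs.simple_mul_simple_cancel_left]
      rw [cs.simple_mul_simple_cancel_left, cs.length_simple]; omega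
    rw [← h1]
    exact mul i _ (ih _ (by omega))

theorem pushforward_T_simple_mul (i : B) (h : Hecke cs φ) :
    pushforward φ ρ (T φ (cs.simple i) * h) =
      T (ρ ∘ φ) (cs.simple i) * pushforward φ ρ h := by
  rw [T_simple_mul, T_simple_mul, pushforward_leftOp]

/-- By semilinearity the left factor may be taken to be `T_w`, a product of elements `T_s`; left
multiplication by `T_s` is `leftOp`, already known to commute with `ρ_*`. -/
theorem pushforward_mul (h k : Hecke cs φ) :
    pushforward φ ρ (h * k) = pushforward φ ρ h * pushforward φ ρ k := by
  induction h using hecke_induction with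
  | zero => simp
  | add x y hx hy => rw [add_mul, map_add, map_add, add_mul, hx, hy]
  | smul a w =>
    rw [smul_mul_assoc, map_smulₛₗ, map_smulₛₗ, smul_mul_assoc]
    congr 1
    refine T_induction (p := fun t => pushforward φ ρ (t * k) = pushforward φ ρ t *
      pushforward φ ρ k) w ?_ fun i v ih => ?_
    · rw [one_mul, pushforward_one, one_mul]
    · rw [mul_assoc, pushforward_T_simple_mul, pushforward_T_simple_mul, ih, mul_assoc]

/-- Induction along a reduced word avoids transporting inverses: only `bar (T_s) = T_s - xi` and
`bar (T_s h) = bar (T_s) bar h` are used. -/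
theorem pushforward_bar_T (w : W) :
    pushforward φ ρ (bar φ (T φ w)) = bar (ρ ∘ φ) (T (ρ ∘ φ) w) := by
  -- The claim becomes a property of the single element `T φ w`, as `T_induction` requires.
  rw [← pushforward_T (φ := φ)]
  refine T_induction (p := fun t => pushforward φ ρ (bar φ t) =
    bar (ρ ∘ φ) (pushforward φ ρ t)) w ?_ fun i v ih => ?_
  · rw [← T_one, bar_T_one, pushforward_T, bar_T_one]
  · rw [bar_T_simple_mul, pushforward_mul, ih, pushforward_T_simple_mul, bar_T_simple_mul,
      bar_T_simple, bar_T_simple, map_sub, map_smulₛₗ, pushforward_T, pushforward_one,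
      groupRingMap_xi]

/-- The two composites are semilinear over the same ring morphism by `groupRingMap_barCoeff`, so
agreement on the basis `(T_w)` is enough. -/
theorem pushforward_bar (h : Hecke cs φ) :
    pushforward φ ρ (bar φ h) = bar (ρ ∘ φ) (pushforward φ ρ h) := by
  induction h using hecke_induction with
  | zero => simp
  | add x y hx hy => simp only [map_add, hx, hy]
  | smul a w =>
    have h1 : bar φ (a • T φ w) = barCoeff Γ a • bar φ (T φ w) := map_smulₛₗ _ _ _
    have h2 : pushforward φ ρ (a • T φ w) = groupRingMap ρ a • T (ρ ∘ φ) w := by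
      rw [map_smulₛₗ, pushforward_T]
    have h3 := map_smulₛₗ (bar (ρ ∘ φ)) (groupRingMap ρ a) (T (ρ ∘ φ) w)
    have h4 := map_smulₛₗ (pushforward φ ρ) (barCoeff Γ a) (bar φ (T φ w))
    rw [h1, h2, h3, h4, groupRingMap_barCoeff, pushforward_bar_T]

end Pushforward

/-! ### Negative coefficients and the image of the Kazhdan-Lusztig basis. -/

section Ordered

variable {B W : Type*} [Group W] {M : CoxeterMatrix B} {cs : CoxeterSystem M W}
variable {Γ Γ' : Type*} [AddCommGroup Γ] [LinearOrder Γ] [AddCommGroup Γ'] [LinearOrder Γ']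
variable {φ : SimpleClass cs → Γ} {ρ : Γ →+ Γ'}

theorem groupRingMap_mem_negCoeff (hρ : StrictMono ρ) {a : GroupRing Γ} (ha : a ∈ negCoeff Γ) :
    groupRingMap ρ a ∈ negCoeff Γ' := by
  intro γ hγ
  change Finsupp.mapDomain ρ a.coeff γ = 0
  by_cases hr : γ ∈ Set.range ρ
  · obtain ⟨δ, rfl⟩ := hr
    rw [Finsupp.mapDomain_apply hρ.injective]
    -- A strictly increasing map from a total order also reflects the order: `ρ 0 = 0 ≤ ρ δ` forces
    -- `0 ≤ δ`.
    exact ha δ (hρ.le_iff_le.1 (by rwa [map_zero]))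
  · exact Finsupp.mapDomain_of_notMem_range _ _ hr

theorem pushforward_mem_heckeNeg (hρ : StrictMono ρ) {h : Hecke cs φ}
    (hh : h ∈ heckeNeg cs φ) : pushforward φ ρ h ∈ heckeNeg cs (ρ ∘ φ) := fun w => by
  rw [repr_pushforward]
  exact groupRingMap_mem_negCoeff hρ (hh w)

variable [IsOrderedAddMonoid Γ] [IsOrderedAddMonoid Γ']

/-- The image satisfies the two conditions that characterize the Kazhdan-Lusztig element, so
uniqueness (`eq_C`) identifies it. -/
theorem pushforward_C (hρ : StrictMono ρ) (w : W) :
    pushforward φ ρ (C φ w) = C (ρ ∘ φ) w := by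
  refine eq_C ?_ ?_
  · rw [← pushforward_bar, bar_C]
  · rw [← pushforward_T (φ := φ), ← map_sub]
    exact pushforward_mem_heckeNeg hρ (C_sub_T_mem w)

/-! ### Coefficients in the Kazhdan-Lusztig basis, and cells. -/

theorem repr_basisC_pushforward (hρ : StrictMono ρ) (h : Hecke cs φ) (w : W) :
    (basisC (ρ ∘ φ)).repr (pushforward φ ρ h) w = groupRingMap ρ ((basisC φ).repr h w) :=
  basis_repr_semilinear _ _ _
    (fun v => by rw [basisC_apply, basisC_apply, pushforward_C hρ]) h w

theorem repr_basisC_pushforward_ne_zero (hρ : StrictMono ρ) (h : Hecke cs φ) (w : W) :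
    (basisC (ρ ∘ φ)).repr (pushforward φ ρ h) w ≠ 0 ↔ (basisC φ).repr h w ≠ 0 := by
  rw [repr_basisC_pushforward hρ,
    map_ne_zero_iff (groupRingMap ρ) (groupRingMap_injective hρ.injective)]

/-- From left to right, `ρ_*` transports the witness. From right to left the witness need not be in
the image of `ρ_*`, and linearity replaces it by some `T_w`, which is. -/
theorem exists_repr_mul_ne_zero_iff (hρ : StrictMono ρ) (x y : W) :
    (∃ h : Hecke cs φ, (basisC φ).repr (h * C φ y) x ≠ 0) ↔
      ∃ h : Hecke cs (ρ ∘ φ), (basisC (ρ ∘ φ)).repr (h * C (ρ ∘ φ) y) x ≠ 0 := by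
  constructor
  · rintro ⟨h, hh⟩
    refine ⟨pushforward φ ρ h, ?_⟩
    rwa [← pushforward_C hρ, ← pushforward_mul, repr_basisC_pushforward_ne_zero hρ]
  · rintro ⟨h, hh⟩
    -- The linear form is `h ↦` coefficient of `C_x` in `h C_y`, over `ℤ[Γ']`.
    obtain ⟨w, hw⟩ := exists_T_ne_zero ((basisC (ρ ∘ φ)).coord x ∘ₗ
      LinearMap.mulRight (GroupRing Γ') (C (ρ ∘ φ) y)) (h := h) hh
    refine ⟨T φ w, ?_⟩
    rw [← repr_basisC_pushforward_ne_zero hρ, pushforward_mul, pushforward_T, pushforward_C hρ]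
    exact hw

theorem exists_repr_mul_ne_zero_iff' (hρ : StrictMono ρ) (x y : W) :
    (∃ h : Hecke cs φ, (basisC φ).repr (C φ y * h) x ≠ 0) ↔
      ∃ h : Hecke cs (ρ ∘ φ), (basisC (ρ ∘ φ)).repr (C (ρ ∘ φ) y * h) x ≠ 0 := by
  constructor
  · rintro ⟨h, hh⟩
    refine ⟨pushforward φ ρ h, ?_⟩
    rwa [← pushforward_C hρ, ← pushforward_mul, repr_basisC_pushforward_ne_zero hρ]
  · rintro ⟨h, hh⟩
    obtain ⟨w, hw⟩ := exists_T_ne_zero ((basisC (ρ ∘ φ)).coord x ∘ₗ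
      LinearMap.mulLeft (GroupRing Γ') (C (ρ ∘ φ) y)) (h := h) hh
    refine ⟨T φ w, ?_⟩
    rw [← repr_basisC_pushforward_ne_zero hρ, pushforward_mul, pushforward_T, pushforward_C hρ]
    exact hw

theorem arrow_comp (hρ : StrictMono ρ) (d : Side) : Arrow (ρ ∘ φ) d = Arrow φ d := by
  funext x y
  cases d with
  | L => exact propext (exists_repr_mul_ne_zero_iff hρ x y).symm
  | R => exact propext (exists_repr_mul_ne_zero_iff' hρ x y).symm
  | LR =>
    -- The existential splits over the disjunction, so the two-sided arrow is the union of the left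
    -- and right ones.
    simp only [Arrow, exists_or]
    rw [← exists_repr_mul_ne_zero_iff hρ, ← exists_repr_mul_ne_zero_iff' hρ]

theorem cellLE_comp (hρ : StrictMono ρ) (d : Side) : CellLE (ρ ∘ φ) d = CellLE φ d := by
  rw [CellLE, CellLE, arrow_comp hρ]

theorem cellEquiv_comp (hρ : StrictMono ρ) (d : Side) :
    CellEquiv (ρ ∘ φ) d = CellEquiv φ d := by
  funext x y
  rw [CellEquiv, CellEquiv, cellLE_comp hρ]

theorem cell_comp (hρ : StrictMono ρ) (d : Side) (w : W) : Cell (ρ ∘ φ) d w = Cell φ d w := by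
  rw [Cell, Cell, cellEquiv_comp hρ]

end Ordered

end HeckeKL

end

theorem mainTheorem6 {B W : Type*} [Group W] {M : CoxeterMatrix B} (cs : CoxeterSystem M W)
    {Γ Γ' : Type*}
    [AddCommGroup Γ] [LinearOrder Γ] [IsOrderedAddMonoid Γ]
    [AddCommGroup Γ'] [LinearOrder Γ'] [IsOrderedAddMonoid Γ']
    (φ : HeckeKL.SimpleClass cs → Γ) (ρ : Γ →+ Γ') (hρ : StrictMono ρ) (d : HeckeKL.Side) :
    Function.Injective (HeckeKL.pushforward φ ρ) ∧
    (∀ w : W, HeckeKL.pushforward φ ρ (HeckeKL.C φ w) = HeckeKL.C (ρ ∘ φ) w) ∧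
    ((∀ x y : W, HeckeKL.CellLE φ d x y ↔ HeckeKL.CellLE (ρ ∘ φ) d x y) ∧
      (∀ x y : W, HeckeKL.CellEquiv φ d x y ↔ HeckeKL.CellEquiv (ρ ∘ φ) d x y)) ∧
    (∀ w : W, HeckeKL.Cell φ d w = HeckeKL.Cell (ρ ∘ φ) d w) := by
  refine ⟨HeckeKL.pushforward_injective hρ.injective, HeckeKL.pushforward_C hρ,
    ⟨fun x y => ?_, fun x y => ?_⟩, fun w => (HeckeKL.cell_comp hρ d w).symm⟩
  · rw [HeckeKL.cellLE_comp hρ]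
  · rw [HeckeKL.cellEquiv_comp hρ]
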